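/- Let $X$ be a (real or complex) Banach space with normed dual $X^*$. Suppose that $X$ has the Dunford–Pettis property: whenever $(x_n)_{n\in\mathbb N}$ is a sequence in $X$ converging weakly to $0$ and $(x_n^*)_{n\in\mathbb N}$ is a sequence in $X^*$ converging weakly to $0$ (that is, in the topology $\sigma(X^*,X^{**})$), the scalars $x_n^*(x_n)$ converge to $0$. Then at least one of the following holds: $X^*$ contains a copy of $\ell_1$, i.e. a linear subspace linearly homeomorphic to $\ell_1$ (over the same scalar field); or $X$ has the Schur property, i.e. every sequence $(x_n)_{n\in\mathbb N}$ in $X$ that converges weakly to $0$ satisfies $\|x_n\|\to 0$. -/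

import Mathlib

open Filter Topology

section

variable (𝕜 : Type*) [RCLike 𝕜] (E : Type*) [NormedAddCommGroup E] [NormedSpace 𝕜 E]

/-- A sequence in a normed space `E` is weakly null if it converges to `0` in the weak topology
`σ(E, E*)`. -/
def WeaklyNull (x : ℕ → E) : Prop :=
  Tendsto (fun n => toWeakSpace 𝕜 E (x n)) atTop (𝓝 (0 : WeakSpace 𝕜 E))

/-- The Dunford–Pettis property: for all weakly null sequences `(xₙ)` in `E` and `(xₙ*)` in the
normed dual `E*` (the latter for the weak topology `σ(E*, E**)`), one has `xₙ*(xₙ) → 0`. -/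
def DunfordPettisProperty : Prop :=
  ∀ (x : ℕ → E) (φ : ℕ → StrongDual 𝕜 E),
    WeaklyNull 𝕜 E x → WeaklyNull 𝕜 (StrongDual 𝕜 E) φ →
      Tendsto (fun n => φ n (x n)) atTop (𝓝 0)

/-- The Schur property: weakly null sequences are norm null. -/
def SchurProperty : Prop :=
  ∀ x : ℕ → E, WeaklyNull 𝕜 E x → Tendsto (fun n => ‖x n‖) atTop (𝓝 0)

/-- `E` contains a copy of `ℓ₁` (with scalars `𝕜`): some linear subspace of `E`, with the norm of
`E`, is linearly homeomorphic to `ℓ₁`. -/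
def ContainsCopyOfEllOne : Prop :=
  ∃ Y : Submodule 𝕜 E, Nonempty (lp (fun _ : ℕ => 𝕜) 1 ≃L[𝕜] Y)

end

/-! Suppose `X*` contains no copy of `ℓ₁` and a weakly null sequence stays `≥ δ` in norm along a
subsequence. Take norming functionals; Rosenthal's `ℓ₁` theorem makes a subsequence `φ k` of them
weakly Cauchy. With `m k ≥ k` so late that `φ k` is small at the vector normed by `φ (m k)`, the
differences `φ (m k) - φ k` are weakly null, so Dunford–Pettis makes those vectors small in norm: a
contradiction.

Rosenthal's theorem rests on a dichotomy for each pair of well-separated discs. Either some infinite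
index set admits no functional in the unit ball oscillating between them, or oscillation persists on
all infinite subsets; then repeated splitting yields independent pairs, hence a lower `ℓ₁`-estimate.
Without `ℓ₁`, diagonalising over countably many pairs of discs forces convergence. -/

/-! ### Combinatorics of infinite index sets -/

/-- A diagonal argument: countably many properties of infinite sets of naturals that are stable
under almost-inclusion and can each be achieved below any infinite set hold simultaneously. -/
theorem exists_infinite_subset_forall {Q : ℕ → Set ℕ → Prop}
    (hQ : ∀ n L L', Q n L → (L' \ L).Finite → Q n L') {M : Set ℕ} (hM : M.Infinite)
    (h : ∀ n, ∀ M' ⊆ M, M'.Infinite → ∃ L ⊆ M', L.Infinite ∧ Q n L) :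
    ∃ L ⊆ M, L.Infinite ∧ ∀ n, Q n L := by
  choose! F hFs hFi hFQ using h
  let Ms : ℕ → Set ℕ := fun k => Nat.rec M (fun k L => F k L) k
  have hMs : ∀ k, Ms k ⊆ M ∧ (Ms k).Infinite := by
    intro k
    induction k with
    | zero => exact ⟨subset_rfl, hM⟩
    | succ k ih => exact ⟨(hFs k _ ih.1 ih.2).trans ih.1, hFi k _ ih.1 ih.2⟩
  have hanti : Antitone Ms := antitone_nat_of_succ_le fun k => hFs k _ (hMs k).1 (hMs k).2
  have hex : ∀ k, ∃ m ∈ Ms k, k < m := fun k => (hMs k).2.exists_gt k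
  choose e he hke using hex
  -- As `Ms` decreases, only finitely many `e k` miss a given `Ms n`; `k < e k` makes the range
  -- infinite without injectivity of `e`.
  refine ⟨Set.range e, ?_, ?_, ?_⟩
  · rintro _ ⟨k, rfl⟩
    exact (hMs k).1 (he k)
  · refine Set.infinite_of_forall_exists_gt fun k => ⟨e k, ⟨k, rfl⟩, hke k⟩
  · intro n
    refine hQ n (Ms (n + 1)) _ (hFQ n _ (hMs n).1 (hMs n).2) ?_
    refine ((Set.finite_Iic n).image e).subset ?_
    rintro _ ⟨⟨k, rfl⟩, hk⟩
    refine ⟨k, ?_, rfl⟩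
    by_contra hnk
    exact hk (hanti (Nat.succ_le_of_lt (not_le.1 hnk)) (he k))

/-- Some point of `S` belongs to `A n` for infinitely many `n ∈ L` and to `B n` for infinitely
many `n ∈ L`. -/
def OscillatesOn {K : Type*} (A B : ℕ → Set K) (L : Set ℕ) (S : Set K) : Prop :=
  ∃ x ∈ S, {n ∈ L | x ∈ A n}.Infinite ∧ {n ∈ L | x ∈ B n}.Infinite

theorem OscillatesOn.of_diff_finite {K : Type*} {A B : ℕ → Set K} {L L' : Set ℕ} {S : Set K}
    (h : OscillatesOn A B L' S) (hL : (L' \ L).Finite) : OscillatesOn A B L S := by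
  obtain ⟨x, hx, hA, hB⟩ := h
  refine ⟨x, hx, (hA.sdiff hL).mono ?_, (hB.sdiff hL).mono ?_⟩ <;>
  · rintro n ⟨⟨hn, hxn⟩, hn'⟩
    exact ⟨by_contra fun hc => hn' ⟨hn, hc⟩, hxn⟩

theorem OscillatesOn.mono_left {K : Type*} {A B : ℕ → Set K} {L L' : Set ℕ} {S : Set K}
    (h : OscillatesOn A B L' S) (hL : L' ⊆ L) : OscillatesOn A B L S :=
  h.of_diff_finite (by simp [Set.sdiff_eq_empty.2 hL])

/-- Rosenthal's splitting lemma. -/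
theorem exists_splitting {K ι : Type*} [Finite ι] (A B : ℕ → Set K) (C : ι → Set K) {M : Set ℕ}
    (hM : M.Infinite) (h : ∀ j, ∀ L ⊆ M, L.Infinite → OscillatesOn A B L (C j)) :
    ∃ n ∈ M, ∃ M' ⊆ M, M'.Infinite ∧ ∀ L ⊆ M', L.Infinite → ∀ j,
      OscillatesOn A B L (C j ∩ A n) ∧ OscillatesOn A B L (C j ∩ B n) := by
  by_contra! hcon
  let D : Bool → ℕ → Set K := fun b n => if b then A n else B n
  -- If no `n` splits, each `n ∈ L` has a cell and a side that fail to oscillate on `L`. Pigeonhole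
  -- fixes both on an infinite `L'`, yet an oscillating point of that cell meets that side for some
  -- `n ∈ L'`.
  obtain ⟨L, hLM, hL, hLQ⟩ := exists_infinite_subset_forall
    (Q := fun n L => n ∈ M → ∃ p : ι × Bool, ¬ OscillatesOn A B L (C p.1 ∩ D p.2 n))
    (fun n L L' hQ hfin hn => (hQ hn).imp fun p hp hc => hp (hc.of_diff_finite hfin)) hM
    (by
      intro n M' hM'M hM'
      by_cases hn : n ∈ M
      · obtain ⟨L, hLM', hL, j, hj⟩ := hcon n hn M' hM'M hM'
        refine ⟨L, hLM', hL, fun _ => ?_⟩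
        by_cases hA : OscillatesOn A B L (C j ∩ A n)
        · exact ⟨(j, false), by simpa [D] using hj hA⟩
        · exact ⟨(j, true), by simpa [D] using hA⟩
      · exact ⟨M', subset_rfl, hM', fun h => absurd h hn⟩)
  have hLQ' : ∀ n : L, ∃ p : ι × Bool, ¬ OscillatesOn A B L (C p.1 ∩ D p.2 n) :=
    fun n => hLQ n (hLM n.2)
  choose p hp using hLQ'
  have : Infinite L := hL.to_subtype
  obtain ⟨⟨j, b⟩, hjb⟩ := Finite.exists_infinite_fiber p
  set L' : Set ℕ := Subtype.val '' (p ⁻¹' {(j, b)}) with hL'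
  have hL'i : L'.Infinite := (Set.infinite_coe_iff.1 hjb).image Subtype.val_injective.injOn
  have hL'L : L' ⊆ L := by
    rintro _ ⟨n, _, rfl⟩
    exact n.2
  obtain ⟨x, hxC, hxA, hxB⟩ := h j L' (hL'L.trans hLM) hL'i
  have hx : ∃ n ∈ L', x ∈ D b n := by
    cases b
    · obtain ⟨n, hn⟩ := hxB.nonempty
      exact ⟨n, hn.1, by simpa [D] using hn.2⟩
    · obtain ⟨n, hn⟩ := hxA.nonempty
      exact ⟨n, hn.1, by simpa [D] using hn.2⟩
  obtain ⟨_, ⟨n, hn, rfl⟩, hxn⟩ := hx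
  have hpn := hp n
  rw [show p n = (j, b) from hn] at hpn
  exact hpn (OscillatesOn.mono_left ⟨x, ⟨hxC, hxn⟩, hxA, hxB⟩ hL'L)

/-- The points that lie in `A i` for `i ∈ l ∩ T` and in `B i` for `i ∈ l \ T`. -/
def signCell {K : Type*} (A B : ℕ → Set K) (l T : Finset ℕ) : Set K :=
  {x | ∀ i ∈ l, (i ∈ T → x ∈ A i) ∧ (i ∉ T → x ∈ B i)}

/-- Only the trace of `T` on `l` matters, so finitely many cells cover all `T`, as the splitting
lemma requires. -/
theorem signCell_inter {K : Type*} (A B : ℕ → Set K) (l T : Finset ℕ) :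
    signCell A B l (T ∩ l) = signCell A B l T := by
  ext x
  simp only [signCell, Set.mem_ofPred_eq]
  refine forall₂_congr fun i hi => ?_
  simp [hi]

/-- If every infinite subset of `M` oscillates, there is an infinite set of indices along which
the pairs `(A n, B n)` are independent. -/
theorem exists_infinite_independent {K : Type*} (A B : ℕ → Set K) {M : Set ℕ} (hM : M.Infinite)
    (h : ∀ L ⊆ M, L.Infinite → OscillatesOn A B L Set.univ) :
    ∃ N : Set ℕ, N.Infinite ∧ ∀ l : Finset ℕ, (l : Set ℕ) ⊆ N → ∀ T,
      (signCell A B l T).Nonempty := by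
  -- Inductive invariant: a reservoir `M` on whose infinite subsets every cell of `l` still
  -- oscillates.
  let P : Finset ℕ → Prop := fun l => ∃ M : Set ℕ, M.Infinite ∧ ∀ T, ∀ L ⊆ M, L.Infinite →
    OscillatesOn A B L (signCell A B l T)
  have hstep : ∀ l, P l → ∃ n ∉ l, P (insert n l) := by
    rintro l ⟨M, hM, hl⟩
    obtain ⟨n, hn, M', hM'M, hM', hspl⟩ := exists_splitting A B
      (fun T : l.powerset => signCell A B l T) (M := M \ l) (hM.sdiff l.finite_toSet)
      (fun T L hL hLi => hl T L (hL.trans Set.sdiff_subset) hLi)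
    refine ⟨n, fun hc => hn.2 hc, M', hM', fun T L hL hLi => ?_⟩
    obtain ⟨hA, hB⟩ := hspl L hL hLi ⟨T ∩ l, Finset.mem_powerset.2 Finset.inter_subset_right⟩
    simp only [signCell_inter] at hA hB
    by_cases hnT : n ∈ T
    · obtain ⟨x, hx, hx'⟩ := hA
      refine ⟨x, fun i hi => ?_, hx'⟩
      rcases Finset.mem_insert.1 hi with rfl | hi
      · exact ⟨fun _ => hx.2, fun hc => absurd hnT hc⟩
      · exact hx.1 i hi
    · obtain ⟨x, hx, hx'⟩ := hB
      refine ⟨x, fun i hi => ?_, hx'⟩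
      rcases Finset.mem_insert.1 hi with rfl | hi
      · exact ⟨fun hc => absurd hc hnT, fun _ => hx.2⟩
      · exact hx.1 i hi
  have h0 : P ∅ := ⟨M, hM, fun T L hL hLi => by
    simpa [signCell] using h L hL hLi⟩
  choose! ν hν hPν using hstep
  obtain ⟨ls, hls0, hls⟩ : ∃ ls : ℕ → Finset ℕ, ls 0 = ∅ ∧
      ∀ k, ls (k + 1) = insert (ν (ls k)) (ls k) :=
    ⟨fun k => Nat.rec ∅ (fun _ l => insert (ν l) l) k, rfl, fun _ => rfl⟩
  have hP : ∀ k, P (ls k) := by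
    intro k
    induction k with
    | zero => exact hls0 ▸ h0
    | succ k ih => exact hls k ▸ hPν _ ih
  have hmono : Monotone ls := monotone_nat_of_le_succ fun k =>
    hls k ▸ Finset.subset_insert _ _
  have hcard : ∀ k, (ls k).card = k := by
    intro k
    induction k with
    | zero => rw [hls0, Finset.card_empty]
    | succ k ih =>
      rw [hls, Finset.card_insert_of_notMem (hν _ (hP k)), ih]
  refine ⟨⋃ k, (ls k : Set ℕ), fun hfin => ?_, fun l hl T => ?_⟩
  · have hle := Finset.card_le_card (s := ls (hfin.toFinset.card + 1)) (t := hfin.toFinset)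
      (fun i hi => hfin.mem_toFinset.2 (Set.mem_iUnion_of_mem (hfin.toFinset.card + 1) hi))
    rw [hcard] at hle
    omega
  · have hdir : Monotone fun k => (ls k : Set ℕ) := fun _ _ hk =>
      Finset.coe_subset.2 (hmono hk)
    obtain ⟨k, hk⟩ := hdir.directed_le.exists_mem_subset_of_finset_subset_biUnion hl
    obtain ⟨M', hM', hosc⟩ := hP k
    obtain ⟨x, hx, -⟩ := hosc T M' subset_rfl hM'
    exact ⟨x, fun i hi => hx i (hk hi)⟩

/-! ### Lower estimates and copies of `ℓ₁` -/

section

variable {𝕜 : Type*} [RCLike 𝕜] {E : Type*} [NormedAddCommGroup E] [NormedSpace 𝕜 E]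

/-- A bounded sequence satisfying a lower `ℓ₁`-estimate spans a copy of `ℓ₁`. -/
theorem containsCopyOfEllOne_of_lower_estimate [CompleteSpace E] (g : ℕ → E) {R c : ℝ}
    (hR : ∀ n, ‖g n‖ ≤ R) (hc : 0 < c)
    (h : ∀ (s : Finset ℕ) (a : ℕ → 𝕜), c * ∑ i ∈ s, ‖a i‖ ≤ ‖∑ i ∈ s, a i • g i‖) :
    ContainsCopyOfEllOne 𝕜 E := by
  have hsn : ∀ a : lp (fun _ : ℕ => 𝕜) 1, HasSum (fun i => ‖a i‖) ‖a‖ := fun a => by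
    simpa using lp.hasSum_norm (p := 1) (by simp) a
  have hle : ∀ (a : lp (fun _ : ℕ => 𝕜) 1) i, ‖a i • g i‖ ≤ ‖a i‖ * R := fun a i => by
    rw [norm_smul]
    exact mul_le_mul_of_nonneg_left (hR i) (norm_nonneg _)
  have hs : ∀ a : lp (fun _ : ℕ => 𝕜) 1, Summable (fun i => a i • g i) := fun a =>
    Summable.of_norm_bounded ((hsn a).summable.mul_right R) (hle a)
  let T : lp (fun _ : ℕ => 𝕜) 1 →ₗ[𝕜] E :=
    { toFun := fun a => ∑' i, a i • g i
      map_add' := fun a b => by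
        rw [← (hs a).tsum_add (hs b)]
        simp [add_smul]
      map_smul' := fun r a => by
        rw [RingHom.id_apply, ← (hs a).tsum_const_smul]
        simp [mul_smul] }
  have hup : ∀ a, ‖T a‖ ≤ R * ‖a‖ := fun a => by
    rw [mul_comm]
    exact tsum_of_norm_bounded ((hsn a).mul_right R) (hle a)
  have hlow : ∀ a, c * ‖a‖ ≤ ‖T a‖ := fun a =>
    le_of_tendsto_of_tendsto' (Tendsto.const_mul c (hsn a)) (hs a).hasSum.norm fun s => h s a
  have hinj : Function.Injective T := by
    refine (injective_iff_map_eq_zero T).2 fun a ha => ?_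
    have := hlow a
    rw [ha, norm_zero] at this
    exact norm_le_zero_iff.1 (nonpos_of_mul_nonpos_right this hc)
  refine ⟨LinearMap.range T, ⟨(LinearEquiv.ofInjective T hinj).toContinuousLinearEquivOfBounds R c⁻¹
    (fun a => hup a) (fun y => ?_)⟩⟩
  have := hlow ((LinearEquiv.ofInjective T hinj).symm y)
  rw [← LinearEquiv.ofInjective_apply (h := hinj), LinearEquiv.apply_symm_apply] at this
  rw [inv_mul_eq_div, le_div_iff₀ hc, mul_comm]
  exact this

/-- Functionals separating the signs of the real parts of the coefficients. -/
theorem sum_re_estimate {g : ℕ → E} {s : Finset ℕ} {a : ℕ → 𝕜} {d₁ d₂ : 𝕜} {ε : ℝ}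
    (ψ₁ ψ₂ : StrongDual 𝕜 E) (h₁ : ‖ψ₁‖ ≤ 1) (h₂ : ‖ψ₂‖ ≤ 1)
    (hp : ∀ i ∈ s, 0 ≤ RCLike.re (a i) → ‖ψ₁ (g i) - d₁‖ ≤ ε ∧ ‖ψ₂ (g i) - d₂‖ ≤ ε)
    (hn : ∀ i ∈ s, ¬ 0 ≤ RCLike.re (a i) → ‖ψ₁ (g i) - d₂‖ ≤ ε ∧ ‖ψ₂ (g i) - d₁‖ ≤ ε) :
    ‖d₁ - d₂‖ * ∑ i ∈ s, |RCLike.re (a i)| ≤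
      2 * ‖∑ i ∈ s, a i • g i‖ + 2 * ε * ∑ i ∈ s, ‖a i‖ := by
  -- `ψ₁ - ψ₂` is within `2 * ε` of `(d₁ - d₂) * σ i` at `g i`, so it detects the sum of the `|re (a
  -- i)|`.
  let σ : ℕ → 𝕜 := fun i => if 0 ≤ RCLike.re (a i) then 1 else -1
  have hre : ∑ i ∈ s, |RCLike.re (a i)| ≤ ‖∑ i ∈ s, a i * σ i‖ := by
    refine le_trans (le_of_eq ?_) (RCLike.re_le_norm _)
    rw [map_sum]
    refine Finset.sum_congr rfl fun i _ => ?_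
    by_cases hi : 0 ≤ RCLike.re (a i)
    · simp [σ, hi, abs_of_nonneg hi]
    · simp [σ, hi, abs_of_neg (not_le.1 hi)]
  have herr : ∀ i ∈ s, ‖a i * ((d₁ - d₂) * σ i - (ψ₁ - ψ₂) (g i))‖ ≤ 2 * ε * ‖a i‖ := by
    intro i hi
    rw [norm_mul, mul_comm]
    refine mul_le_mul_of_nonneg_right ?_ (norm_nonneg _)
    by_cases hs : 0 ≤ RCLike.re (a i)
    · obtain ⟨k₁, k₂⟩ := hp i hi hs
      have : (d₁ - d₂) * σ i - (ψ₁ - ψ₂) (g i) = (ψ₂ (g i) - d₂) - (ψ₁ (g i) - d₁) := by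
        simp only [σ, hs, if_true, sub_apply]; ring
      rw [this]
      exact (norm_sub_le _ _).trans (by linarith)
    · obtain ⟨k₁, k₂⟩ := hn i hi hs
      have : (d₁ - d₂) * σ i - (ψ₁ - ψ₂) (g i) = (ψ₂ (g i) - d₁) - (ψ₁ (g i) - d₂) := by
        simp only [σ, hs, if_false, sub_apply]; ring
      rw [this]
      exact (norm_sub_le _ _).trans (by linarith)
  have hdec : (d₁ - d₂) * ∑ i ∈ s, a i * σ i = (ψ₁ - ψ₂) (∑ i ∈ s, a i • g i) +
      ∑ i ∈ s, a i * ((d₁ - d₂) * σ i - (ψ₁ - ψ₂) (g i)) := by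
    rw [map_sum, ← Finset.sum_add_distrib, Finset.mul_sum]
    refine Finset.sum_congr rfl fun i _ => ?_
    rw [map_smul, smul_eq_mul]; ring
  calc ‖d₁ - d₂‖ * ∑ i ∈ s, |RCLike.re (a i)| ≤ ‖d₁ - d₂‖ * ‖∑ i ∈ s, a i * σ i‖ :=
        mul_le_mul_of_nonneg_left hre (norm_nonneg _)
    _ = ‖(ψ₁ - ψ₂) (∑ i ∈ s, a i • g i) +
      ∑ i ∈ s, a i * ((d₁ - d₂) * σ i - (ψ₁ - ψ₂) (g i))‖ := by rw [← norm_mul, hdec]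
    _ ≤ _ := by
      refine (norm_add_le _ _).trans (add_le_add ?_ ?_)
      · refine ((ψ₁ - ψ₂).le_opNorm _).trans (mul_le_mul_of_nonneg_right ?_ (norm_nonneg _))
        exact (norm_sub_le _ _).trans (by linarith)
      · rw [Finset.mul_sum]
        exact norm_sum_le_of_le _ herr

/-- Functionals in the dual unit ball whose value at `f n` is close to `d`. -/
def nearValue (f : ℕ → E) (d : 𝕜) (ε : ℝ) (n : ℕ) : Set {ψ : StrongDual 𝕜 E // ‖ψ‖ ≤ 1} :=
  {ψ | ‖ψ.1 (f n) - d‖ ≤ ε}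

/-- Independence of two well-separated value sets gives a lower `ℓ₁`-estimate. -/
theorem lower_estimate_of_independent {g : ℕ → E} {d₁ d₂ : 𝕜} {ε : ℝ} (hε : 0 ≤ ε)
    (h : ∀ s T : Finset ℕ, (signCell (nearValue g d₁ ε) (nearValue g d₂ ε) s T).Nonempty)
    (s : Finset ℕ) (a : ℕ → 𝕜) :
    (‖d₁ - d₂‖ - 4 * ε) / 4 * ∑ i ∈ s, ‖a i‖ ≤ ‖∑ i ∈ s, a i • g i‖ := by
  have key : ∀ b : ℕ → 𝕜, ‖d₁ - d₂‖ * ∑ i ∈ s, |RCLike.re (b i)| ≤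
      2 * ‖∑ i ∈ s, b i • g i‖ + 2 * ε * ∑ i ∈ s, ‖b i‖ := by
    intro b
    obtain ⟨ψ₁, k₁⟩ := h s (s.filter fun i => 0 ≤ RCLike.re (b i))
    obtain ⟨ψ₂, k₂⟩ := h s (s.filter fun i => ¬ 0 ≤ RCLike.re (b i))
    refine sum_re_estimate ψ₁.1 ψ₂.1 ψ₁.2 ψ₂.2 (fun i hi hs => ⟨?_, ?_⟩) (fun i hi hs => ⟨?_, ?_⟩)
    · exact (k₁ i hi).1 (Finset.mem_filter.2 ⟨hi, hs⟩)
    · exact (k₂ i hi).2 fun hc => (Finset.mem_filter.1 hc).2 hs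
    · exact (k₁ i hi).2 fun hc => hs (Finset.mem_filter.1 hc).2
    · exact (k₂ i hi).1 (Finset.mem_filter.2 ⟨hi, hs⟩)
  have hI : ‖(RCLike.I : 𝕜)‖ ≤ 1 := by rw [RCLike.norm_I]; split_ifs <;> simp
  have e₁ := key a
  -- Multiplying by `I` turns imaginary parts into real ones up to sign; over `ℝ`, where `I = 0`,
  -- this is vacuous. Adding both estimates gives the factor `4`.
  have e₂ := key fun i => RCLike.I * a i
  have hIm : ∀ i, |RCLike.re (RCLike.I * a i)| = |RCLike.im (a i)| := fun i => by
    simp [RCLike.mul_re, RCLike.I_im']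
  have hnI : ‖∑ i ∈ s, (RCLike.I * a i) • g i‖ ≤ ‖∑ i ∈ s, a i • g i‖ := by
    simp_rw [mul_smul]
    rw [← Finset.smul_sum, norm_smul]
    exact mul_le_of_le_one_left (norm_nonneg _) hI
  have hnI' : ∑ i ∈ s, ‖RCLike.I * a i‖ ≤ ∑ i ∈ s, ‖a i‖ := Finset.sum_le_sum fun i _ => by
    rw [norm_mul]
    exact mul_le_of_le_one_left (norm_nonneg _) hI
  simp_rw [hIm] at e₂
  have hsum : ∑ i ∈ s, ‖a i‖ ≤ ∑ i ∈ s, |RCLike.re (a i)| + ∑ i ∈ s, |RCLike.im (a i)| := by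
    rw [← Finset.sum_add_distrib]
    refine Finset.sum_le_sum fun i _ => ?_
    calc ‖a i‖ = ‖(RCLike.re (a i) : 𝕜) + RCLike.im (a i) * RCLike.I‖ := by rw [RCLike.re_add_im]
      _ ≤ |RCLike.re (a i)| + |RCLike.im (a i)| * ‖(RCLike.I : 𝕜)‖ := by
        refine (norm_add_le _ _).trans (le_of_eq ?_)
        rw [norm_mul, RCLike.norm_ofReal, RCLike.norm_ofReal]
      _ ≤ _ := by
        gcongr
        exact mul_le_of_le_one_right (abs_nonneg _) hI
  have h1 := mul_le_mul_of_nonneg_left hsum (norm_nonneg (d₁ - d₂))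
  have h2 := mul_le_mul_of_nonneg_left hnI' hε
  linarith

/-! ### Rosenthal's theorem -/

/-- A bounded scalar sequence that, for every pair of well-separated small balls, meets one of
them only finitely often, is Cauchy. -/
theorem cauchySeq_of_not_oscillating {u : ℕ → 𝕜} {R : ℝ} (hu : ∀ n, ‖u n‖ ≤ R)
    (h : ∀ i j m : ℕ, 4 * (1 / ((m : ℝ) + 1)) <
        ‖TopologicalSpace.denseSeq 𝕜 i - TopologicalSpace.denseSeq 𝕜 j‖ →
      ¬ ((∃ᶠ n in atTop, ‖u n - TopologicalSpace.denseSeq 𝕜 i‖ ≤ 1 / ((m : ℝ) + 1)) ∧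
        ∃ᶠ n in atTop, ‖u n - TopologicalSpace.denseSeq 𝕜 j‖ ≤ 1 / ((m : ℝ) + 1))) :
    CauchySeq u := by
  have hK : IsCompact (Metric.closedBall (0 : 𝕜) R) := isCompact_closedBall _ _
  have huK : ∀ n, u n ∈ Metric.closedBall (0 : 𝕜) R := fun n => by simpa using hu n
  obtain ⟨a, -, ha⟩ := hK.exists_mapClusterPt_of_frequently (Frequently.of_forall huK : ∃ᶠ n in atTop, _)
  refine (hK.tendsto_nhds_of_unique_mapClusterPt (Eventually.of_forall huK) fun b _ hb => ?_ :
    Tendsto u atTop (𝓝 a)).cauchySeq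
  by_contra hab
  have hpos : 0 < ‖b - a‖ := norm_pos_iff.2 (sub_ne_zero.2 hab)
  -- Centres within `η / 2` of two cluster points more than `6 * η` apart are still more than `4 *
  -- η` apart.
  obtain ⟨m, hm⟩ := exists_nat_one_div_lt (show 0 < ‖b - a‖ / 6 by positivity)
  have hm0 : (0 : ℝ) < 1 / ((m : ℝ) + 1) := by positivity
  set η : ℝ := 1 / ((m : ℝ) + 1)
  obtain ⟨i, hi⟩ := (TopologicalSpace.denseRange_denseSeq 𝕜).exists_dist_lt a (half_pos hm0)
  obtain ⟨j, hj⟩ := (TopologicalSpace.denseRange_denseSeq 𝕜).exists_dist_lt b (half_pos hm0)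
  have hfreq : ∀ c d : 𝕜, dist c d < η / 2 → MapClusterPt c atTop u →
      ∃ᶠ n in atTop, ‖u n - d‖ ≤ η := by
    intro c d hcd hc
    refine (hc.frequently (Metric.ball_mem_nhds c (half_pos hm0))).mono fun n hn => ?_
    rw [← dist_eq_norm]
    have := dist_triangle (u n) c d
    have hn' : dist (u n) c < η / 2 := hn
    linarith
  refine h i j m ?_ ⟨hfreq a _ hi ha, hfreq b _ hj hb⟩
  rw [← dist_eq_norm] at hm ⊢
  have h1 := dist_triangle4 b (TopologicalSpace.denseSeq 𝕜 j) (TopologicalSpace.denseSeq 𝕜 i) a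
  rw [dist_comm a] at hi
  rw [dist_comm (TopologicalSpace.denseSeq 𝕜 j)] at h1
  change 4 * η < _
  linarith

/-- Rosenthal's `ℓ₁` theorem, for real or complex scalars. -/
theorem exists_weaklyCauchy_subseq [CompleteSpace E] (hE : ¬ ContainsCopyOfEllOne 𝕜 E)
    (f : ℕ → E) {R : ℝ} (hf : ∀ n, ‖f n‖ ≤ R) :
    ∃ e : ℕ → ℕ, StrictMono e ∧ ∀ ψ : StrongDual 𝕜 E, CauchySeq fun n => ψ (f (e n)) := by
  let d := TopologicalSpace.denseSeq 𝕜
  -- `k` encodes two centres and a radius `1 / (m + 1)`.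
  let O : ℕ → Set ℕ → Prop := fun k L =>
    OscillatesOn (nearValue f (d k.unpair.1) (1 / ((k.unpair.2.unpair.2 : ℝ) + 1)))
      (nearValue f (d k.unpair.2.unpair.1) (1 / ((k.unpair.2.unpair.2 : ℝ) + 1))) L Set.univ
  let sep : ℕ → Prop := fun k => 4 * (1 / ((k.unpair.2.unpair.2 : ℝ) + 1)) <
    ‖d k.unpair.1 - d k.unpair.2.unpair.1‖
  have hstep : ∀ k, ∀ M ⊆ (Set.univ : Set ℕ), M.Infinite →
      ∃ L ⊆ M, L.Infinite ∧ (sep k → ¬ O k L) := by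
    intro k M _ hM
    by_cases hk : sep k
    swap
    · exact ⟨M, subset_rfl, hM, fun h => absurd h hk⟩
    by_contra! hcon
    obtain ⟨N, hN, hind⟩ := exists_infinite_independent _ _ hM fun L hL hLi => (hcon L hL hLi).2
    refine hE (containsCopyOfEllOne_of_lower_estimate (fun n => f (hN.natEmbedding N n)) (R := R)
      (fun n => hf _) (c := (‖d k.unpair.1 - d k.unpair.2.unpair.1‖ -
        4 * (1 / ((k.unpair.2.unpair.2 : ℝ) + 1))) / 4) ?_
      (lower_estimate_of_independent (by positivity) fun s T => ?_))
    · have : 4 * (1 / ((k.unpair.2.unpair.2 : ℝ) + 1)) <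
        ‖d k.unpair.1 - d k.unpair.2.unpair.1‖ := hk
      linarith
    · let ι : ℕ ↪ ℕ := (hN.natEmbedding N).trans (Function.Embedding.subtype _)
      obtain ⟨ψ, hψ⟩ := hind (s.map ι) (by
        intro i hi
        obtain ⟨j, _, rfl⟩ := Finset.mem_map.1 (Finset.mem_coe.1 hi)
        exact (hN.natEmbedding N j).2) (T.map ι)
      refine ⟨ψ, fun i hi => ?_⟩
      have := hψ (ι i) (Finset.mem_map_of_mem ι hi)
      rwa [Finset.mem_map'] at this
  obtain ⟨L, -, hL, hLO⟩ := exists_infinite_subset_forall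
    (fun k L L' h hfin hk hc => h hk (hc.of_diff_finite hfin)) Set.infinite_univ hstep
  refine ⟨Nat.nth (· ∈ L), Nat.nth_strictMono hL, ?_⟩
  have hball : ∀ ψ : StrongDual 𝕜 E, ‖ψ‖ ≤ 1 → CauchySeq fun n => ψ (f (Nat.nth (· ∈ L) n)) := by
    intro ψ hψ
    refine cauchySeq_of_not_oscillating (R := R)
      (fun n => (ψ.le_of_opNorm_le hψ _).trans (by simpa using hf _)) fun i j m hsep hc => ?_
    refine hLO (Nat.pair i (Nat.pair j m)) (by simpa [sep] using hsep) ⟨⟨ψ, hψ⟩, Set.mem_univ _, ?_⟩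
    have hinf : ∀ P : ℕ → Prop, (∃ᶠ n in atTop, P (Nat.nth (· ∈ L) n)) → {n ∈ L | P n}.Infinite := by
      intro P hP
      refine ((Nat.frequently_atTop_iff_infinite.1 hP).image
        (Nat.nth_injective hL).injOn).mono ?_
      rintro _ ⟨n, hn, rfl⟩
      exact ⟨Nat.nth_mem_of_infinite hL n, hn⟩
    simp only [Nat.unpair_pair]
    exact ⟨hinf (fun n => ‖ψ (f n) - d i‖ ≤ 1 / ((m : ℝ) + 1)) hc.1,
      hinf (fun n => ‖ψ (f n) - d j‖ ≤ 1 / ((m : ℝ) + 1)) hc.2⟩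
  intro ψ
  by_cases hψ : ψ = 0
  · simpa [hψ] using cauchySeq_const (0 : 𝕜)
  have hn : (‖ψ‖ : 𝕜) ≠ 0 := by simpa using hψ
  have hC := hball ((‖ψ‖ : 𝕜)⁻¹ • ψ) (by
    rw [norm_smul, norm_inv, RCLike.norm_ofReal, abs_norm,
      inv_mul_cancel₀ (norm_ne_zero_iff.2 hψ)])
  simpa [Function.comp_def, mul_inv_cancel_left₀ hn] using (uniformContinuous_const_smul (‖ψ‖ : 𝕜)).comp_cauchySeq hC

/-! ### Weak nullity and the dichotomy -/

theorem weaklyNull_iff {x : ℕ → E} :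
    WeaklyNull 𝕜 E x ↔ ∀ ψ : StrongDual 𝕜 E, Tendsto (fun n => ψ (x n)) atTop (𝓝 0) := by
  have hinj : Function.Injective (topDualPairing 𝕜 E).flip := fun x y h =>
    SeparatingDual.eq_iff_forall_dual_eq (R := 𝕜) |>.2 fun ψ => LinearMap.congr_fun h ψ
  refine (WeakBilin.tendsto_iff_forall_eval_tendsto _ hinj).trans (forall_congr' fun ψ => ?_)
  have h0 : 𝓝 ((topDualPairing 𝕜 E).flip 0 ψ) = 𝓝 0 := congrArg 𝓝 (map_zero ψ)
  exact Eq.to_iff (congrArg (Tendsto (fun n => ψ (x n)) atTop) h0)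

end

theorem mainTheorem4 (𝕜 : Type*) [RCLike 𝕜]
    (X : Type*) [NormedAddCommGroup X] [NormedSpace 𝕜 X] [CompleteSpace X]
    (hX : DunfordPettisProperty 𝕜 X) :
    ContainsCopyOfEllOne 𝕜 (StrongDual 𝕜 X) ∨ SchurProperty 𝕜 X := by
  refine or_iff_not_imp_left.2 fun hE x hx => ?_
  by_contra hnot
  have hx' := weaklyNull_iff.1 hx
  obtain ⟨δ, hδ, hfreq⟩ : ∃ δ > 0, ∃ᶠ n in atTop, δ ≤ ‖x n‖ := by
    by_contra! hc
    refine hnot (Metric.tendsto_nhds.2 fun δ hδ => ?_)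
    simpa using hc δ hδ
  obtain ⟨e₀, he₀, hxe⟩ := extraction_of_frequently_atTop hfreq
  choose φ hφ hφx using fun n => exists_dual_vector'' 𝕜 (x (e₀ n))
  obtain ⟨e, he, hcau⟩ := exists_weaklyCauchy_subseq hE φ (R := 1) hφ
  have hlim : Tendsto (fun n => e₀ (e n)) atTop atTop := he₀.tendsto_atTop.comp he.tendsto_atTop
  -- `φ (e k)` is fixed while the vectors are weakly null; `m ≥ k` later makes the differences of
  -- functionals weakly null.
  have hex : ∀ k, ∃ m ≥ k, ‖φ (e k) (x (e₀ (e m)))‖ < δ / 2 := by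
    intro k
    have h1 := ((hx' (φ (e k))).comp hlim).norm
    rw [norm_zero] at h1
    exact ((eventually_ge_atTop k).and (h1.eventually (gt_mem_nhds (half_pos hδ)))).exists
  choose m hmk hm using hex
  have hmlim : Tendsto m atTop atTop := tendsto_atTop_mono hmk tendsto_id
  have h0 := hX (fun k => x (e₀ (e (m k)))) (fun k => φ (e (m k)) - φ (e k))
    (weaklyNull_iff.2 fun ψ => (hx' ψ).comp (hlim.comp hmlim))
    (weaklyNull_iff.2 fun ψ => by
      obtain ⟨l, hl⟩ := cauchySeq_tendsto_of_complete (hcau ψ)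
      simpa using (hl.comp hmlim).sub hl)
  obtain ⟨k, hk⟩ := ((h0.norm.eventually (gt_mem_nhds (show ‖(0 : 𝕜)‖ < δ / 2 by simpa using half_pos hδ)))).exists
  have h1 : ‖φ (e (m k)) (x (e₀ (e (m k))))‖ = ‖x (e₀ (e (m k)))‖ := by
    rw [hφx, RCLike.norm_ofReal, abs_norm]
  have h2 := norm_sub_norm_le (φ (e (m k)) (x (e₀ (e (m k))))) (φ (e k) (x (e₀ (e (m k)))))
  have h3 := hxe (e (m k))
  have h4 := hm k
  rw [sub_apply] at hk
  linarith
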